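/- Let $\mathbb{M}_n$ denote the space of $n\times n$ matrices over $\mathbb{C}$ (or over $\mathbb{R}$, in which case "unitary" means "orthogonal" and $^*$ is the transpose). For $Z\in\mathbb{M}_n$ let $|Z|=(Z^*Z)^{1/2}$ and $$|Z|_{\mathrm{qsym}}:=\sqrt{\frac{|Z|^2+|Z^*|^2}{2}},$$ where the square roots are the positive semidefinite ones. Let $A,B\in\mathbb{M}_n$. Then there exist unitaries $U,V\in\mathbb{M}_n$ such that $$U e^{-|A|_{\mathrm{qsym}}}U^*+V e^{-|B|_{\mathrm{qsym}}}V^*\le I+e^{-|A+B|_{\mathrm{qsym}}},$$ where $I$ is the identity matrix and $X\le Y$ means that $Y-X$ is positive semidefinite. -/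

import Mathlib

open scoped MatrixOrder Matrix

/-- The quadratic symmetric modulus `|Z|_qsym = √((|Z|² + |Z*|²) / 2)` of a square matrix over
`ℝ` or `ℂ`. Here `CFC.abs Z = √(Z* Z)` is the (right) modulus, and `CFC.sqrt` is the positive
semidefinite square root of a positive semidefinite matrix. -/
noncomputable def qsymModulus {𝕜 : Type*} [RCLike 𝕜] {n : ℕ}
    (Z : Matrix (Fin n) (Fin n) 𝕜) : Matrix (Fin n) (Fin n) 𝕜 :=
  CFC.sqrt ((2⁻¹ : ℝ) • (CFC.abs Z ^ 2 + CFC.abs Zᴴ ^ 2))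

/-! Up to the factor `1/√2`, stacking `Z` on `Zᴴ` gives a column whose modulus is `|Z|_qsym`, and
this column is additive in `Z`. Thompson's triangle inequality for rectangular matrices
(`exists_conjDiag_le_add_of_sq`) therefore bounds `|A+B|_qsym` by a sum of unitary conjugates of
`|A|_qsym` and `|B|_qsym`.

The function `f(t) = 1 - e^{-t}` is concave and increasing with `f(0) = 0`, hence subadditive on
positive matrices up to unitary conjugations (`exists_conjDiag_comp_le_add`). Applying it to the
triangle inequality and rearranging gives the claim.

Every unitary that is not a mere change of order of factors comes from Weyl's principle
(`IsHermitian.exists_le_conj_conjDiag`): it suffices to bound a quadratic form on spans of the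
lowest eigenvectors. -/

namespace Matrix

open scoped ComplexOrder

variable {𝕜 : Type*} [RCLike 𝕜] {m : Type*} [Fintype m] {n : ℕ}

/-! ### Quadratic forms of matrices. -/

/-- The squared Euclidean norm of a vector. -/
noncomputable def normSqVec (x : m → 𝕜) : ℝ := ∑ i, ‖x i‖ ^ 2

/-- The real quadratic form `x ↦ Re ⟨x, M x⟩`. -/
noncomputable def quadForm (M : Matrix m m 𝕜) (x : m → 𝕜) : ℝ :=
  RCLike.re (star x ⬝ᵥ M *ᵥ x)

/-- The Hermitian matrix with eigenbasis the columns of `Q` and eigenvalues `d`. -/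
noncomputable def conjDiag (Q : Matrix (Fin n) (Fin n) 𝕜) (d : Fin n → ℝ) :
    Matrix (Fin n) (Fin n) 𝕜 :=
  Q * diagonal (fun i => (d i : 𝕜)) * Qᴴ

lemma normSqVec_eq (x : m → 𝕜) : normSqVec x = RCLike.re (star x ⬝ᵥ x) := by
  simp only [normSqVec, dotProduct, map_sum, Pi.star_apply]
  refine Finset.sum_congr rfl fun i _ => ?_
  rw [RCLike.star_def, RCLike.conj_mul, ← RCLike.ofReal_pow, RCLike.ofReal_re]

lemma normSqVec_pos {x : m → 𝕜} (hx : x ≠ 0) : 0 < normSqVec x := by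
  obtain ⟨i, hi⟩ := Function.ne_iff.mp hx
  exact Finset.sum_pos' (fun _ _ => by positivity)
    ⟨i, Finset.mem_univ i, by have := norm_pos_iff.mpr hi; positivity⟩

lemma normSqVec_smul (c : 𝕜) (x : m → 𝕜) : normSqVec (c • x) = ‖c‖ ^ 2 * normSqVec x := by
  simp [normSqVec, Finset.mul_sum, mul_pow]

lemma quadForm_one [DecidableEq m] (x : m → 𝕜) : quadForm 1 x = normSqVec x := by
  simp [quadForm, normSqVec_eq]

lemma quadForm_add (M N : Matrix m m 𝕜) (x : m → 𝕜) :
    quadForm (M + N) x = quadForm M x + quadForm N x := by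
  simp [quadForm, add_mulVec, dotProduct_add]

lemma quadForm_sub (M N : Matrix m m 𝕜) (x : m → 𝕜) :
    quadForm (M - N) x = quadForm M x - quadForm N x := by
  simp [quadForm, sub_mulVec, dotProduct_sub]

lemma quadForm_smul_vec (M : Matrix m m 𝕜) (c : 𝕜) (x : m → 𝕜) :
    quadForm M (c • x) = ‖c‖ ^ 2 * quadForm M x := by
  rw [quadForm, quadForm, mulVec_smul, star_smul, smul_dotProduct, dotProduct_smul, smul_eq_mul,
    smul_eq_mul, ← mul_assoc, RCLike.star_def, RCLike.conj_mul, ← RCLike.ofReal_pow,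
    RCLike.re_ofReal_mul]

lemma quadForm_conjTranspose_mul {p : Type*} [Fintype p] (S T : Matrix m p 𝕜) (x : p → 𝕜) :
    quadForm (Sᴴ * T) x = RCLike.re (star (S *ᵥ x) ⬝ᵥ (T *ᵥ x)) := by
  rw [quadForm, star_mulVec, ← dotProduct_mulVec, mulVec_mulVec]

lemma quadForm_conjTranspose_mul_self {p : Type*} [Fintype p] (S : Matrix m p 𝕜) (x : p → 𝕜) :
    quadForm (Sᴴ * S) x = normSqVec (S *ᵥ x) := by
  rw [quadForm_conjTranspose_mul, normSqVec_eq]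

lemma quadForm_conj {p : Type*} [Fintype p] (S : Matrix m p 𝕜) (M : Matrix m m 𝕜) (x : p → 𝕜) :
    quadForm (Sᴴ * M * S) x = quadForm M (S *ᵥ x) := by
  rw [Matrix.mul_assoc, quadForm_conjTranspose_mul, quadForm, mulVec_mulVec]

lemma quadForm_conjTranspose (M : Matrix m m 𝕜) (x : m → 𝕜) :
    quadForm Mᴴ x = quadForm M x := by
  rw [quadForm, quadForm, dotProduct_mulVec, ← star_mulVec, ← RCLike.conj_re, ← RCLike.star_def,
    star_dotProduct, star_star]

lemma quadForm_mono {M N : Matrix m m 𝕜} (h : M ≤ N) (x : m → 𝕜) :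
    quadForm M x ≤ quadForm N x := by
  have := (RCLike.nonneg_iff.mp ((le_iff.mp h).dotProduct_mulVec_nonneg x)).1
  rw [← sub_nonneg, ← quadForm_sub]
  exact this

lemma re_dotProduct_le (a b : m → 𝕜) :
    RCLike.re (star a ⬝ᵥ b) ≤ √(normSqVec a) * √(normSqVec b) := by
  have := (RCLike.re_le_norm _).trans
    (norm_inner_le_norm (𝕜 := 𝕜) (WithLp.toLp 2 a) (WithLp.toLp 2 b))
  rw [EuclideanSpace.norm_eq, EuclideanSpace.norm_eq, EuclideanSpace.inner_eq_star_dotProduct,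
    dotProduct_comm] at this
  exact this

lemma conj_le_conj {M N : Matrix m m 𝕜} (h : M ≤ N) (U : Matrix m m 𝕜) :
    U * M * Uᴴ ≤ U * N * Uᴴ := by
  rw [le_iff, ← Matrix.sub_mul, ← Matrix.mul_sub]
  exact (le_iff.mp h).mul_mul_conjTranspose_same U

lemma conjTranspose_mul_self_of_mem {U : Matrix (Fin n) (Fin n) 𝕜}
    (hU : U ∈ unitaryGroup (Fin n) 𝕜) : Uᴴ * U = 1 :=
  mem_unitaryGroup_iff'.mp hU

lemma mul_conjTranspose_self_of_mem {U : Matrix (Fin n) (Fin n) 𝕜}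
    (hU : U ∈ unitaryGroup (Fin n) 𝕜) : U * Uᴴ = 1 :=
  mem_unitaryGroup_iff.mp hU

lemma conjTranspose_mem {U : Matrix (Fin n) (Fin n) 𝕜}
    (hU : U ∈ unitaryGroup (Fin n) 𝕜) : Uᴴ ∈ unitaryGroup (Fin n) 𝕜 :=
  mem_unitaryGroup_iff.mpr (by
    rw [star_eq_conjTranspose, conjTranspose_conjTranspose, conjTranspose_mul_self_of_mem hU])

/-! ### Spectral decompositions with ordered eigenvalues. -/

section conjDiag

variable {Q : Matrix (Fin n) (Fin n) 𝕜}

lemma conjDiag_isHermitian (Q : Matrix (Fin n) (Fin n) 𝕜) (d : Fin n → ℝ) :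
    (conjDiag Q d).IsHermitian := by
  refine isHermitian_mul_mul_conjTranspose _ ?_
  rw [isHermitian_diagonal_iff]
  intro i
  exact RCLike.conj_ofReal _

lemma conj_conjDiag (U Q : Matrix (Fin n) (Fin n) 𝕜) (d : Fin n → ℝ) :
    U * conjDiag Q d * Uᴴ = conjDiag (U * Q) d := by
  simp only [conjDiag, conjTranspose_mul, Matrix.mul_assoc]

lemma conjDiag_mul (hQ : Q ∈ unitaryGroup (Fin n) 𝕜) (c d : Fin n → ℝ) :
    conjDiag Q c * conjDiag Q d = conjDiag Q (fun i => c i * d i) := by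
  have : conjDiag Q c * conjDiag Q d = Q * diagonal (fun i => (c i : 𝕜)) * (Qᴴ * Q) *
      diagonal (fun i => (d i : 𝕜)) * Qᴴ := by
    simp only [conjDiag, Matrix.mul_assoc]
  rw [this, conjTranspose_mul_self_of_mem hQ, Matrix.mul_one, Matrix.mul_assoc Q,
    diagonal_mul_diagonal, conjDiag]
  simp

lemma conjDiag_one (hQ : Q ∈ unitaryGroup (Fin n) 𝕜) : conjDiag Q (fun _ => 1) = 1 := by
  simp [conjDiag, mul_conjTranspose_self_of_mem hQ]

lemma conjDiag_sub (Q : Matrix (Fin n) (Fin n) 𝕜) (c d : Fin n → ℝ) :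
    conjDiag Q (fun i => c i - d i) = conjDiag Q c - conjDiag Q d := by
  simp only [conjDiag, ← Matrix.sub_mul, ← Matrix.mul_sub, diagonal_sub, RCLike.ofReal_sub]

lemma conjDiag_neg (Q : Matrix (Fin n) (Fin n) 𝕜) (d : Fin n → ℝ) :
    -conjDiag Q d = conjDiag Q (fun i => -d i) := by
  have := conjDiag_sub Q (fun _ => 0) d
  simp only [zero_sub] at this
  rw [this]
  simp [conjDiag]

lemma conjDiag_le_conjDiag (Q : Matrix (Fin n) (Fin n) 𝕜) {c d : Fin n → ℝ} (h : ∀ i, c i ≤ d i) :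
    conjDiag Q c ≤ conjDiag Q d := by
  rw [le_iff, ← conjDiag_sub]
  refine PosSemidef.mul_mul_conjTranspose_same (PosSemidef.diagonal fun i => ?_) Q
  simpa using h i

lemma exp_conjDiag (hQ : Q ∈ unitaryGroup (Fin n) 𝕜) (d : Fin n → ℝ) :
    NormedSpace.exp (conjDiag Q d) = conjDiag Q (fun i => Real.exp (d i)) := by
  have hinv : Q⁻¹ = Qᴴ := inv_eq_right_inv (mul_conjTranspose_self_of_mem hQ)
  have hu : IsUnit Q := IsUnit.of_mul_eq_one _ (mul_conjTranspose_self_of_mem hQ)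
  rw [conjDiag, ← hinv, exp_conj _ _ hu, exp_diagonal, hinv, conjDiag]
  congr 3
  ext i
  rw [Pi.coe_exp, Real.exp_eq_exp_ℝ]
  exact (NormedSpace.algebraMap_exp_comm (𝕂 := ℝ) (𝔸 := 𝕜) (d i)).symm

lemma quadForm_conjDiag (Q : Matrix (Fin n) (Fin n) 𝕜) (d : Fin n → ℝ) (x : Fin n → 𝕜) :
    quadForm (conjDiag Q d) x = ∑ i, d i * ‖(Qᴴ *ᵥ x) i‖ ^ 2 := by
  have : conjDiag Q d = (Qᴴ)ᴴ * diagonal (fun i => (d i : 𝕜)) * Qᴴ := by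
    rw [conjTranspose_conjTranspose, conjDiag]
  rw [this, quadForm_conj, quadForm, dotProduct, map_sum]
  refine Finset.sum_congr rfl fun i _ => ?_
  rw [mulVec_diagonal, Pi.star_apply, RCLike.star_def, mul_left_comm, RCLike.conj_mul,
    ← RCLike.ofReal_pow, ← RCLike.ofReal_mul, RCLike.ofReal_re]

lemma normSqVec_conjTranspose_mulVec (hQ : Q ∈ unitaryGroup (Fin n) 𝕜) (x : Fin n → 𝕜) :
    ∑ i, ‖(Qᴴ *ᵥ x) i‖ ^ 2 = normSqVec x := by
  rw [← quadForm_one, ← conjDiag_one hQ, quadForm_conjDiag]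
  simp

/-- This and the next lemma are the two halves of the min-max principle. -/
lemma quadForm_conjDiag_le (hQ : Q ∈ unitaryGroup (Fin n) 𝕜) {d : Fin n → ℝ} (hd : Monotone d)
    {j : Fin n} {x : Fin n → 𝕜} (hx : ∀ i, j < i → (Qᴴ *ᵥ x) i = 0) :
    quadForm (conjDiag Q d) x ≤ d j * normSqVec x := by
  rw [quadForm_conjDiag, ← normSqVec_conjTranspose_mulVec hQ, Finset.mul_sum]
  refine Finset.sum_le_sum fun i _ => ?_
  rcases le_or_gt i j with h | h
  · exact mul_le_mul_of_nonneg_right (hd h) (by positivity)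
  · simp [hx i h]

lemma le_quadForm_conjDiag (hQ : Q ∈ unitaryGroup (Fin n) 𝕜) {d : Fin n → ℝ} (hd : Monotone d)
    {j : Fin n} {x : Fin n → 𝕜} (hx : ∀ i, i < j → (Qᴴ *ᵥ x) i = 0) :
    d j * normSqVec x ≤ quadForm (conjDiag Q d) x := by
  rw [quadForm_conjDiag, ← normSqVec_conjTranspose_mulVec hQ, Finset.mul_sum]
  refine Finset.sum_le_sum fun i _ => ?_
  rcases le_or_gt j i with h | h
  · exact mul_le_mul_of_nonneg_right (hd h) (by positivity)
  · simp [hx i h]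

lemma IsHermitian.exists_monotone_conjDiag {M : Matrix (Fin n) (Fin n) 𝕜} (hM : M.IsHermitian) :
    ∃ Q ∈ unitaryGroup (Fin n) 𝕜, ∃ d : Fin n → ℝ, Monotone d ∧ M = conjDiag Q d := by
  set σ := Tuple.sort hM.eigenvalues
  set P := (hM.eigenvectorUnitary : Matrix (Fin n) (Fin n) 𝕜)
  refine ⟨P.submatrix id σ, ?_, hM.eigenvalues ∘ σ, Tuple.monotone_sort _, ?_⟩
  · rw [mem_unitaryGroup_iff, star_eq_conjTranspose, conjTranspose_submatrix,
      submatrix_mul_equiv, mul_conjTranspose_self_of_mem hM.eigenvectorUnitary.2, submatrix_id_id]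
  · have hdiag : diagonal (fun i => (((hM.eigenvalues ∘ σ) i : ℝ) : 𝕜)) =
        (diagonal (fun i => (hM.eigenvalues i : 𝕜))).submatrix σ σ := by
      rw [submatrix_diagonal_equiv]; rfl
    rw [conjDiag, hdiag, conjTranspose_submatrix, submatrix_mul_equiv, submatrix_mul_equiv,
      submatrix_id_id]
    exact hM.spectral_theorem

lemma PosSemidef.exists_monotone_conjDiag {M : Matrix (Fin n) (Fin n) 𝕜} (hM : M.PosSemidef) :
    ∃ Q ∈ unitaryGroup (Fin n) 𝕜, ∃ d : Fin n → ℝ,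
      Monotone d ∧ (∀ i, 0 ≤ d i) ∧ M = conjDiag Q d := by
  obtain ⟨Q, hQ, d, hd, rfl⟩ := hM.1.exists_monotone_conjDiag
  refine ⟨Q, hQ, d, hd, fun i => ?_, rfl⟩
  have h := quadForm_mono (nonneg_iff_posSemidef.mpr hM) (Q *ᵥ Pi.single i 1)
  rw [quadForm_conjDiag, mulVec_mulVec, conjTranspose_mul_self_of_mem hQ, one_mulVec,
    Finset.sum_eq_single i (fun k _ hk => by simp [Pi.single_eq_of_ne hk]) (by simp)] at h
  simpa [quadForm] using h

end conjDiag

/-! ### Domination up to unitary conjugation. -/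

/-- A form of Weyl's monotonicity principle: if `M` is bounded by `c j` on the span of the first
`j + 1` columns of `Q`, for each `j`, then `M` is dominated by a unitary conjugate of
`conjDiag Q c`. -/
lemma IsHermitian.exists_le_conj_conjDiag {M Q : Matrix (Fin n) (Fin n) 𝕜} (hM : M.IsHermitian)
    (hQ : Q ∈ unitaryGroup (Fin n) 𝕜) {c : Fin n → ℝ}
    (h : ∀ j x, (∀ i, j < i → (Qᴴ *ᵥ x) i = 0) → normSqVec x = 1 → quadForm M x ≤ c j) :
    ∃ U ∈ unitaryGroup (Fin n) 𝕜, M ≤ U * conjDiag Q c * Uᴴ := by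
  obtain ⟨P, hP, l, hl, rfl⟩ := hM.exists_monotone_conjDiag
  have hlc : ∀ j, l j ≤ c j := by
    intro j
    -- Dimension count: orthogonality to the columns of `P` below `j` and to those of `Q` above `j`
    -- is `n - 1` conditions. Row `j` is zero, so a common nonzero solution exists.
    set F : Matrix (Fin n) (Fin n) 𝕜 :=
      of fun i => if i < j then Pᴴ i else if j < i then Qᴴ i else 0 with hF
    have hdet : F.det = 0 := det_eq_zero_of_row_eq_zero j fun k => by simp [F]
    obtain ⟨v, hv, hFv⟩ := exists_mulVec_eq_zero_iff.mpr hdet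
    have hpos := normSqVec_pos hv
    have hP' : ∀ i, i < j → (Pᴴ *ᵥ v) i = 0 := fun i hi => by
      simpa [F, mulVec, hi] using congrFun hFv i
    have hQ' : ∀ i, j < i → (Qᴴ *ᵥ v) i = 0 := fun i hi => by
      simpa [F, mulVec, hi, hi.not_gt] using congrFun hFv i
    set r : 𝕜 := (((√(normSqVec v))⁻¹ : ℝ) : 𝕜)
    have hr : ‖r‖ ^ 2 = (normSqVec v)⁻¹ := by
      rw [RCLike.norm_ofReal, sq_abs, inv_pow, Real.sq_sqrt hpos.le]
    have h1 := h j (r • v) (fun i hi => by rw [mulVec_smul, Pi.smul_apply, hQ' i hi, smul_zero])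
      (by rw [normSqVec_smul, hr, inv_mul_cancel₀ hpos.ne'])
    have h2 := le_quadForm_conjDiag hP hl hP'
    rw [quadForm_smul_vec, hr, inv_mul_le_iff₀ hpos] at h1
    rw [mul_comm] at h2
    exact le_of_mul_le_mul_left (h2.trans h1) hpos
  refine ⟨P * Qᴴ, mul_mem hP (conjTranspose_mem hQ), ?_⟩
  rw [conj_conjDiag, Matrix.mul_assoc, conjTranspose_mul_self_of_mem hQ, Matrix.mul_one]
  exact conjDiag_le_conjDiag P hlc

/-- The two products share a characteristic polynomial, hence their eigenvalues. -/
lemma exists_mul_conjTranspose_eq_conj (M : Matrix (Fin n) (Fin n) 𝕜) :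
    ∃ U ∈ unitaryGroup (Fin n) 𝕜, Mᴴ * M = U * (M * Mᴴ) * Uᴴ := by
  have h1 := (posSemidef_conjTranspose_mul_self M).1
  have h2 := (posSemidef_self_mul_conjTranspose M).1
  have he : h1.eigenvalues = h2.eigenvalues :=
    (h1.eigenvalues_eq_eigenvalues_iff h2).mpr (charpoly_mul_comm _ _)
  obtain ⟨P, hP, e1⟩ : ∃ P ∈ unitaryGroup (Fin n) 𝕜, Mᴴ * M = conjDiag P h1.eigenvalues :=
    ⟨_, h1.eigenvectorUnitary.2, h1.spectral_theorem⟩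
  obtain ⟨R, hR, e2⟩ : ∃ R ∈ unitaryGroup (Fin n) 𝕜, M * Mᴴ = conjDiag R h2.eigenvalues :=
    ⟨_, h2.eigenvectorUnitary.2, h2.spectral_theorem⟩
  refine ⟨P * Rᴴ, mul_mem hP (conjTranspose_mem hR), e1.trans ?_⟩
  generalize h2.eigenvalues = l at he e2
  rw [he, e2, conj_conjDiag, Matrix.mul_assoc, conjTranspose_mul_self_of_mem hR, Matrix.mul_one]

/-! ### Concave functions and subadditivity. -/

section Concave

variable {f : ℝ → ℝ} {Q : Matrix (Fin n) (Fin n) 𝕜}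

/-- Jensen's inequality for quadratic forms of matrix functions. -/
lemma quadForm_conjDiag_comp_le (hf : ConcaveOn ℝ (Set.Ici 0) f)
    (hQ : Q ∈ unitaryGroup (Fin n) 𝕜) {d : Fin n → ℝ} (hd : ∀ i, 0 ≤ d i) {x : Fin n → 𝕜}
    (hx : normSqVec x = 1) :
    quadForm (conjDiag Q (f ∘ d)) x ≤ f (quadForm (conjDiag Q d) x) := by
  rw [quadForm_conjDiag, quadForm_conjDiag]
  have := hf.le_map_sum (t := Finset.univ) (w := fun i => ‖(Qᴴ *ᵥ x) i‖ ^ 2) (p := d)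
    (fun i _ => by positivity) (by rw [normSqVec_conjTranspose_mulVec hQ, hx]) (fun i _ => hd i)
  simpa only [smul_eq_mul, mul_comm, Function.comp] using this

/-- `f` need not be operator monotone, so a conjugation is needed: Jensen and the scalar
monotonicity of `f` bound the form by `f (d j)`, and Weyl's principle applies. -/
lemma exists_conjDiag_comp_le_of_le (hf : ConcaveOn ℝ (Set.Ici 0) f)
    (hmono : MonotoneOn f (Set.Ici 0)) {P : Matrix (Fin n) (Fin n) 𝕜}
    (hP : P ∈ unitaryGroup (Fin n) 𝕜) (hQ : Q ∈ unitaryGroup (Fin n) 𝕜) {c d : Fin n → ℝ}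
    (hc : ∀ i, 0 ≤ c i) (hd : ∀ i, 0 ≤ d i) (hdm : Monotone d)
    (h : conjDiag P c ≤ conjDiag Q d) :
    ∃ U ∈ unitaryGroup (Fin n) 𝕜,
      conjDiag P (f ∘ c) ≤ U * conjDiag Q (f ∘ d) * Uᴴ := by
  refine (conjDiag_isHermitian _ _).exists_le_conj_conjDiag hQ fun j x hx h1 => ?_
  refine (quadForm_conjDiag_comp_le hf hP hc h1).trans (hmono ?_ (hd j) ?_)
  · rw [quadForm_conjDiag]
    exact Finset.sum_nonneg fun i _ => mul_nonneg (hc i) (by positivity)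
  · simpa [h1] using (quadForm_mono h x).trans (quadForm_conjDiag_le hQ hdm hx)

/-- The compression step in the subadditivity inequality: if `0 ≤ X ≤ H`, then
`f(H)^{1/2} H^{-1/2} X H^{-1/2} f(H)^{1/2}` is dominated by a unitary conjugate of `f(X)`. -/
lemma exists_conj_conjDiag_sqrt_div_le (hf : ConcaveOn ℝ (Set.Ici 0) f)
    (hmono : MonotoneOn f (Set.Ici 0)) (hf0 : f 0 = 0) {P : Matrix (Fin n) (Fin n) 𝕜}
    (hP : P ∈ unitaryGroup (Fin n) 𝕜) (hQ : Q ∈ unitaryGroup (Fin n) 𝕜) {a h : Fin n → ℝ}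
    (ha : ∀ i, 0 ≤ a i) (ham : Monotone a) (hh : ∀ i, 0 ≤ h i)
    (hle : conjDiag P a ≤ conjDiag Q h) :
    ∃ U ∈ unitaryGroup (Fin n) 𝕜,
      conjDiag Q (fun i => √(f (h i) / h i)) * conjDiag P a *
        conjDiag Q (fun i => √(f (h i) / h i)) ≤ U * conjDiag P (f ∘ a) * Uᴴ := by
  have hfnn : ∀ t, 0 ≤ t → 0 ≤ f t := fun t ht => hf0 ▸ hmono (Set.mem_Ici.mpr le_rfl) ht ht
  set L := conjDiag Q (fun i => √(f (h i) / h i))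
  set G := conjDiag P (fun i => √(a i))
  -- Since `0⁻¹ = 0`, this is the pseudo-inverse of `H^{1/2}`, so `H` may be singular.
  set K := conjDiag Q (fun i => (√(h i))⁻¹)
  have hL : Lᴴ = L := conjDiag_isHermitian _ _
  have hG : Gᴴ = G := conjDiag_isHermitian _ _
  have hK : Kᴴ = K := conjDiag_isHermitian _ _
  have hGG : G * G = conjDiag P a := by
    rw [conjDiag_mul hP]; simp only [Real.mul_self_sqrt (ha _)]
  have hLL : L * L = conjDiag Q (fun i => f (h i) / h i) := by
    rw [conjDiag_mul hQ]
    simp only [Real.mul_self_sqrt (div_nonneg (hfnn _ (hh _)) (hh _))]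
  have hKK : K * K = conjDiag Q (fun i => (h i)⁻¹) := by
    rw [conjDiag_mul hQ]
    simp only [← mul_inv, Real.mul_self_sqrt (hh _)]
  -- With `X = G²`, this is unitarily similar to `K X K`, and `K X K ≤ K H K`, a projection.
  have hcontr : G * (K * K) * G ≤ 1 := by
    obtain ⟨V, hV, hVe⟩ := exists_mul_conjTranspose_eq_conj (K * G)
    rw [conjTranspose_mul, hG, hK] at hVe
    have e1 : G * (K * K) * G = V * (K * conjDiag P a * Kᴴ) * Vᴴ := by
      rw [hK, ← hGG]; simpa only [Matrix.mul_assoc] using hVe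
    have e2 : K * conjDiag Q h * Kᴴ ≤ 1 := by
      rw [hK, conjDiag_mul hQ, conjDiag_mul hQ, ← conjDiag_one hQ]
      refine conjDiag_le_conjDiag Q fun i => ?_
      rw [mul_right_comm, ← mul_inv, Real.mul_self_sqrt (hh i)]
      exact inv_mul_le_one
    rw [e1]
    refine (conj_le_conj ((conj_le_conj hle K).trans e2) V).trans_eq ?_
    rw [Matrix.mul_one, mul_conjTranspose_self_of_mem hV]
  obtain ⟨V, hV, hVe⟩ := exists_mul_conjTranspose_eq_conj (G * L)
  -- Swapping the factors puts `G` outside, where it acts on spans of eigenvectors of `X`.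
  have e : L * conjDiag P a * L = V * (G * (L * L) * G) * Vᴴ := by
    rw [conjTranspose_mul, hG, hL] at hVe
    rw [← hGG]; simpa only [Matrix.mul_assoc] using hVe
  have hherm : (G * (L * L) * G).IsHermitian := by
    have := isHermitian_mul_mul_conjTranspose G (A := L * L)
      (by rw [hLL]; exact conjDiag_isHermitian _ _)
    rwa [hG] at this
  obtain ⟨U, hU, hUle⟩ := hherm.exists_le_conj_conjDiag hP (c := f ∘ a) fun j x hx h1 => by
    have eq (N : Matrix (Fin n) (Fin n) 𝕜) : quadForm (G * N * G) x = quadForm N (G *ᵥ x) := by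
      rw [← quadForm_conj, hG]
    have hw1 : ∑ i, (h i)⁻¹ * ‖(Qᴴ *ᵥ (G *ᵥ x)) i‖ ^ 2 ≤ 1 := by
      rw [← quadForm_conjDiag, ← hKK, ← eq, ← h1, ← quadForm_one]
      exact quadForm_mono hcontr x
    have hw2 : normSqVec (G *ᵥ x) ≤ a j := by
      rw [← quadForm_conjTranspose_mul_self, hG, hGG]
      simpa [h1] using quadForm_conjDiag_le hP ham hx
    rw [eq, hLL, quadForm_conjDiag]
    set w : Fin n → ℝ := fun i => (h i)⁻¹ * ‖(Qᴴ *ᵥ (G *ᵥ x)) i‖ ^ 2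
    have hw0 : ∀ i, 0 ≤ w i := fun i => mul_nonneg (inv_nonneg.mpr (hh i)) (by positivity)
    -- The weights sum to at most `1`; the missing mass is placed at `0`, where `f` vanishes.
    have hJ := hf.map_add_sum_le (t := Finset.univ) (w := w) (p := h) (v := 1 - ∑ i, w i) (q := 0)
      (fun i _ => hw0 i) (by ring) (fun i _ => hh i) (sub_nonneg.mpr hw1) (Set.mem_Ici.mpr le_rfl)
    simp only [hf0, smul_eq_mul, mul_zero, zero_add] at hJ
    refine le_trans (le_of_eq ?_) (hJ.trans (hmono ?_ (ha j) (le_trans ?_ hw2)))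
    · exact Finset.sum_congr rfl fun i _ => by simp only [w]; ring
    · exact Finset.sum_nonneg fun i _ => mul_nonneg (hw0 i) (hh i)
    · rw [← normSqVec_conjTranspose_mulVec hQ]
      refine Finset.sum_le_sum fun i _ => ?_
      simp only [w]
      rw [mul_right_comm]
      exact mul_le_of_le_one_left (by positivity) inv_mul_le_one
  refine ⟨V * U, mul_mem hV hU, ?_⟩
  rw [e]
  refine (conj_le_conj hUle V).trans_eq ?_
  simp only [conjTranspose_mul, Matrix.mul_assoc]

/-- Subadditivity of concave functions of positive semidefinite matrices, up to unitary
conjugations. -/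
theorem exists_conjDiag_comp_le_add (hf : ConcaveOn ℝ (Set.Ici 0) f)
    (hmono : MonotoneOn f (Set.Ici 0)) (hf0 : f 0 = 0) {P R : Matrix (Fin n) (Fin n) 𝕜}
    (hP : P ∈ unitaryGroup (Fin n) 𝕜) (hR : R ∈ unitaryGroup (Fin n) 𝕜)
    (hQ : Q ∈ unitaryGroup (Fin n) 𝕜) {a b c : Fin n → ℝ}
    (ha : ∀ i, 0 ≤ a i) (ham : Monotone a) (hb : ∀ i, 0 ≤ b i) (hbm : Monotone b)
    (hc : ∀ i, 0 ≤ c i) (hle : conjDiag Q c ≤ conjDiag P a + conjDiag R b) :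
    ∃ U ∈ unitaryGroup (Fin n) 𝕜, ∃ V ∈ unitaryGroup (Fin n) 𝕜,
      conjDiag Q (f ∘ c) ≤ U * conjDiag P (f ∘ a) * Uᴴ + V * conjDiag R (f ∘ b) * Vᴴ := by
  have hfnn : ∀ t, 0 ≤ t → 0 ≤ f t := fun t ht => hf0 ▸ hmono (Set.mem_Ici.mpr le_rfl) ht ht
  have nonneg {T : Matrix (Fin n) (Fin n) 𝕜} {d : Fin n → ℝ} (hd : ∀ i, 0 ≤ d i) :
      0 ≤ conjDiag T d := by
    simpa [conjDiag] using conjDiag_le_conjDiag T (c := fun _ => 0) hd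
  obtain ⟨S, hS, h, hhm, hh, hsum⟩ :=
    (nonneg_iff_posSemidef.mp (add_nonneg (nonneg (T := P) ha) (nonneg (T := R) hb))
      ).exists_monotone_conjDiag
  obtain ⟨W, hW, hWle⟩ := exists_conjDiag_comp_le_of_le hf hmono hQ hS hc hh hhm (hsum ▸ hle)
  obtain ⟨U, hU, hUle⟩ := exists_conj_conjDiag_sqrt_div_le hf hmono hf0 hP hS ha ham hh
    (hsum ▸ le_add_of_nonneg_right (nonneg hb))
  obtain ⟨V, hV, hVle⟩ := exists_conj_conjDiag_sqrt_div_le hf hmono hf0 hR hS hb hbm hh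
    (hsum ▸ le_add_of_nonneg_left (nonneg ha))
  have key : conjDiag S (f ∘ h) ≤
      U * conjDiag P (f ∘ a) * Uᴴ + V * conjDiag R (f ∘ b) * Vᴴ := by
    refine le_trans (le_of_eq ?_) (add_le_add hUle hVle)
    rw [← Matrix.add_mul, ← Matrix.mul_add, hsum, conjDiag_mul hS, conjDiag_mul hS]
    congr 1
    ext i
    rw [mul_right_comm, Real.mul_self_sqrt (div_nonneg (hfnn _ (hh i)) (hh i)), Function.comp]
    rcases eq_or_ne (h i) 0 with h0 | h0
    · simp [h0, hf0]
    · rw [div_mul_cancel₀ _ h0]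
  refine ⟨W * U, mul_mem hW hU, W * V, mul_mem hW hV,
    hWle.trans ((conj_le_conj key W).trans_eq ?_)⟩
  simp only [conjTranspose_mul, Matrix.mul_assoc, Matrix.mul_add, Matrix.add_mul]

end Concave

/-! ### Thompson's triangle inequality. -/

section Triangle

/-- If `W` is a contraction and `N ^ 2 = Sᴴ S` with `N` positive semidefinite, then the Hermitian
part of `Wᴴ S` is dominated by a unitary conjugate of `N`. -/
lemma exists_hermitianPart_le_conj {W S : Matrix m (Fin n) 𝕜} (hW : Wᴴ * W ≤ 1)
    {Q : Matrix (Fin n) (Fin n) 𝕜} (hQ : Q ∈ unitaryGroup (Fin n) 𝕜) {d : Fin n → ℝ}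
    (hd : ∀ i, 0 ≤ d i) (hdm : Monotone d) (hS : conjDiag Q d * conjDiag Q d = Sᴴ * S) :
    ∃ U ∈ unitaryGroup (Fin n) 𝕜,
      (2⁻¹ : ℝ) • (Wᴴ * S + Sᴴ * W) ≤ U * conjDiag Q d * Uᴴ := by
  have hherm : ((2⁻¹ : ℝ) • (Wᴴ * S + Sᴴ * W)).IsHermitian := by
    rw [IsHermitian, conjTranspose_smul, conjTranspose_add, conjTranspose_mul, conjTranspose_mul,
      conjTranspose_conjTranspose, conjTranspose_conjTranspose, add_comm, star_trivial]
  -- On the span of the first `j + 1` eigenvectors, Cauchy–Schwarz gives `Re ⟨Wx, Sx⟩ ≤ ‖Sx‖ ≤ d j`.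
  refine hherm.exists_le_conj_conjDiag hQ fun j x hx h1 => ?_
  have e : quadForm ((2⁻¹ : ℝ) • (Wᴴ * S + Sᴴ * W)) x =
      RCLike.re (star (W *ᵥ x) ⬝ᵥ (S *ᵥ x)) := by
    have h2 : quadForm (Sᴴ * W) x = quadForm (Wᴴ * S) x := by
      rw [← quadForm_conjTranspose, conjTranspose_mul, conjTranspose_conjTranspose]
    have h3 : quadForm ((2⁻¹ : ℝ) • (Wᴴ * S + Sᴴ * W)) x =
        2⁻¹ * quadForm (Wᴴ * S + Sᴴ * W) x := by
      rw [quadForm, quadForm, smul_mulVec, dotProduct_smul, RCLike.smul_re]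
    rw [h3, quadForm_add, h2, quadForm_conjTranspose_mul]
    ring
  have hWx : √(normSqVec (W *ᵥ x)) ≤ 1 := by
    rw [← Real.sqrt_one]
    refine Real.sqrt_le_sqrt ?_
    rw [← quadForm_conjTranspose_mul_self, ← h1, ← quadForm_one]
    exact quadForm_mono hW x
  have hSx : √(normSqVec (S *ᵥ x)) ≤ d j := by
    refine Real.sqrt_le_iff.mpr ⟨hd j, ?_⟩
    rw [← quadForm_conjTranspose_mul_self, ← hS, conjDiag_mul hQ, sq]
    simpa [h1] using quadForm_conjDiag_le hQ
      (fun i k hik => mul_le_mul (hdm hik) (hdm hik) (hd i) (hd k)) hx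
  rw [e]
  refine (re_dotProduct_le _ _).trans ?_
  simpa using mul_le_mul hWx hSx (Real.sqrt_nonneg _) zero_le_one

/-- Thompson's triangle inequality for rectangular matrices. -/
theorem exists_conjDiag_le_add_of_sq {S T : Matrix m (Fin n) 𝕜} {P R Q : Matrix (Fin n) (Fin n) 𝕜}
    (hP : P ∈ unitaryGroup (Fin n) 𝕜) (hR : R ∈ unitaryGroup (Fin n) 𝕜)
    (hQ : Q ∈ unitaryGroup (Fin n) 𝕜) {a b c : Fin n → ℝ}
    (ha : ∀ i, 0 ≤ a i) (ham : Monotone a) (hb : ∀ i, 0 ≤ b i) (hbm : Monotone b)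
    (hS : conjDiag P a * conjDiag P a = Sᴴ * S) (hT : conjDiag R b * conjDiag R b = Tᴴ * T)
    (hST : conjDiag Q c * conjDiag Q c = (S + T)ᴴ * (S + T)) :
    ∃ U ∈ unitaryGroup (Fin n) 𝕜, ∃ V ∈ unitaryGroup (Fin n) 𝕜,
      conjDiag Q c ≤ U * conjDiag P a * Uᴴ + V * conjDiag R b * Vᴴ := by
  -- A pseudo-inverse of the modulus: `W = (S + T) * K` is the polar partial isometry, and `Wᴴ * (S
  -- + T)` is the modulus, which thus splits into the Hermitian parts of `Wᴴ * S` and `Wᴴ * T`.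
  set K := conjDiag Q (fun i => (c i)⁻¹)
  have hK : Kᴴ = K := conjDiag_isHermitian _ _
  have hWS : ((S + T) * K)ᴴ * (S + T) = conjDiag Q c := by
    rw [conjTranspose_mul, hK, Matrix.mul_assoc, ← hST, conjDiag_mul hQ, conjDiag_mul hQ]
    congr 1
    ext i
    rcases eq_or_ne (c i) 0 with h0 | h0
    · simp [h0]
    · field_simp
  have hW : ((S + T) * K)ᴴ * ((S + T) * K) ≤ 1 := by
    rw [← Matrix.mul_assoc, hWS, conjDiag_mul hQ, ← conjDiag_one hQ]
    exact conjDiag_le_conjDiag Q fun i => mul_inv_le_one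
  obtain ⟨U, hU, hUle⟩ := exists_hermitianPart_le_conj hW hP ha ham hS
  obtain ⟨V, hV, hVle⟩ := exists_hermitianPart_le_conj hW hR hb hbm hT
  refine ⟨U, hU, V, hV, le_trans (le_of_eq ?_) (add_le_add hUle hVle)⟩
  have hSW : (S + T)ᴴ * ((S + T) * K) = conjDiag Q c := by
    have := congrArg conjTranspose hWS
    rwa [conjTranspose_mul, conjTranspose_conjTranspose, conjDiag_isHermitian] at this
  have : ((S + T) * K)ᴴ * S + Sᴴ * ((S + T) * K) + (((S + T) * K)ᴴ * T + Tᴴ * ((S + T) * K)) =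
      conjDiag Q c + conjDiag Q c := by
    nth_rw 1 [← hWS]
    rw [← hSW, Matrix.mul_add _ S T, conjTranspose_add, Matrix.add_mul Sᴴ]
    abel
  rw [← smul_add, this, ← two_smul ℝ, smul_smul, inv_mul_cancel₀ two_ne_zero, one_smul]

end Triangle

end Matrix

/-! ### The quadratic symmetric modulus as the modulus of a column. -/

section qsymModulus

open scoped ComplexOrder

variable {𝕜 : Type*} [RCLike 𝕜] {n : ℕ}

/-- The rectangular matrix with blocks `Z` and `Zᴴ`, scaled so that its modulus is
`qsymModulus Z`. -/
noncomputable def qsymColumn (Z : Matrix (Fin n) (Fin n) 𝕜) :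
    Matrix (Fin n ⊕ Fin n) (Fin n) 𝕜 :=
  √(2⁻¹ : ℝ) • Matrix.fromRows Z Zᴴ

lemma qsymColumn_add (A B : Matrix (Fin n) (Fin n) 𝕜) :
    qsymColumn (A + B) = qsymColumn A + qsymColumn B := by
  rw [qsymColumn, qsymColumn, qsymColumn, ← smul_add, Matrix.conjTranspose_add]
  congr 1
  ext (i | i) j <;> simp

lemma qsymModulus_posSemidef (Z : Matrix (Fin n) (Fin n) 𝕜) : (qsymModulus Z).PosSemidef :=
  Matrix.nonneg_iff_posSemidef.mp (CFC.sqrt_nonneg _)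

lemma qsymModulus_mul_self (Z : Matrix (Fin n) (Fin n) 𝕜) :
    qsymModulus Z * qsymModulus Z = (qsymColumn Z)ᴴ * qsymColumn Z := by
  have h : (2⁻¹ : ℝ) • (CFC.abs Z ^ 2 + CFC.abs Zᴴ ^ 2) = (qsymColumn Z)ᴴ * qsymColumn Z := by
    rw [CFC.abs_sq, CFC.abs_sq, qsymColumn, Matrix.conjTranspose_smul,
      Matrix.conjTranspose_fromRows_eq_fromCols_conjTranspose, Matrix.smul_mul, Matrix.mul_smul,
      smul_smul, star_trivial (√(2⁻¹ : ℝ)), Real.mul_self_sqrt (by positivity), Matrix.fromCols_mul_fromRows]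
    rfl
  have h0 : 0 ≤ (2⁻¹ : ℝ) • (CFC.abs Z ^ 2 + CFC.abs Zᴴ ^ 2) := by
    rw [h, Matrix.nonneg_iff_posSemidef]
    exact Matrix.posSemidef_conjTranspose_mul_self _
  rw [qsymModulus, CFC.sqrt_mul_sqrt_self _ h0, h]

end qsymModulus

lemma concaveOn_one_sub_exp_neg : ConcaveOn ℝ Set.univ fun t : ℝ => 1 - Real.exp (-t) := by
  have h : ConvexOn ℝ Set.univ fun t : ℝ => Real.exp (-t) := by
    exact convexOn_exp.comp_linearMap (-LinearMap.id : ℝ →ₗ[ℝ] ℝ)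
  exact (concaveOn_const 1 convex_univ).sub h

open Matrix in
theorem corollary5p1 {𝕜 : Type*} [RCLike 𝕜] (n : ℕ) (A B : Matrix (Fin n) (Fin n) 𝕜) :
    ∃ U ∈ Matrix.unitaryGroup (Fin n) 𝕜, ∃ V ∈ Matrix.unitaryGroup (Fin n) 𝕜,
      U * NormedSpace.exp (-qsymModulus A) * Uᴴ + V * NormedSpace.exp (-qsymModulus B) * Vᴴ
        ≤ 1 + NormedSpace.exp (-qsymModulus (A + B)) := by
  obtain ⟨P, hP, a, ham, ha, hA⟩ := (qsymModulus_posSemidef A).exists_monotone_conjDiag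
  obtain ⟨R, hR, b, hbm, hb, hB⟩ := (qsymModulus_posSemidef B).exists_monotone_conjDiag
  obtain ⟨Q, hQ, c, -, hc, hAB⟩ := (qsymModulus_posSemidef (A + B)).exists_monotone_conjDiag
  obtain ⟨U, hU, V, hV, h⟩ := exists_conjDiag_le_add_of_sq hP hR hQ ha ham hb hbm
    (S := qsymColumn A) (T := qsymColumn B) (c := c)
    (by rw [← hA, qsymModulus_mul_self]) (by rw [← hB, qsymModulus_mul_self])
    (by rw [← hAB, qsymModulus_mul_self, qsymColumn_add])
  -- The unitaries are absorbed into the eigenbases, the form that subadditivity takes.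
  rw [conj_conjDiag, conj_conjDiag] at h
  obtain ⟨U', hU', V', hV', h'⟩ := exists_conjDiag_comp_le_add
    (concaveOn_one_sub_exp_neg.subset (Set.subset_univ _) (convex_Ici 0))
    (fun s _ t _ hst => sub_le_sub_left (Real.exp_le_exp.mpr (neg_le_neg hst)) 1) (by simp) (mul_mem hU hP) (mul_mem hV hR) hQ
    ha ham hb hbm hc h
  have expand {T : Matrix (Fin n) (Fin n) 𝕜} (hT : T ∈ unitaryGroup (Fin n) 𝕜) (d : Fin n → ℝ) :
      conjDiag T ((fun t : ℝ => 1 - Real.exp (-t)) ∘ d) =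
        1 - NormedSpace.exp (-conjDiag T d) := by
    rw [conjDiag_neg, exp_conjDiag hT, ← conjDiag_one hT, ← conjDiag_sub]
    rfl
  have expConj {W T : Matrix (Fin n) (Fin n) 𝕜} (hW : W ∈ unitaryGroup (Fin n) 𝕜)
      (hT : T ∈ unitaryGroup (Fin n) 𝕜) (d : Fin n → ℝ) :
      NormedSpace.exp (-conjDiag (W * T) d) = W * NormedSpace.exp (-conjDiag T d) * Wᴴ := by
    rw [conjDiag_neg, conjDiag_neg, exp_conjDiag hT, exp_conjDiag (mul_mem hW hT), conj_conjDiag]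
  refine ⟨U' * U, mul_mem hU' hU, V' * V, mul_mem hV' hV, ?_⟩
  rw [expand (mul_mem hU hP), expand (mul_mem hV hR), expand hQ, expConj hU hP, expConj hV hR,
    ← hA, ← hB, ← hAB, Matrix.mul_sub, Matrix.mul_sub, Matrix.sub_mul, Matrix.sub_mul,
    Matrix.mul_one, Matrix.mul_one, mul_conjTranspose_self_of_mem hU',
    mul_conjTranspose_self_of_mem hV'] at h'
  have e (X Y N : Matrix (Fin n) (Fin n) 𝕜) : X * Y * N * (X * Y)ᴴ = X * (Y * N * Yᴴ) * Xᴴ := by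
    simp only [conjTranspose_mul, Matrix.mul_assoc]
  rw [e, e]
  rw [← sub_nonneg] at h' ⊢
  refine h'.trans_eq ?_
  abel
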